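/- Let $\{0,1\}^n$ carry the uniform measure. For $g:\{0,1\}^n\to\mathbb R$ and $0\le\epsilon\le 1/2$ let $T_\epsilon g(x)=\mathbb E\,g(x+Z)$, where $Z$ has independent Bernoulli($\epsilon$) coordinates and addition is mod 2, and let $\hat g(A)=\mathbb E\big[g(x)(-1)^{\sum_{i\in A}x_i}\big]$ for $A\subseteq\{1,\dots,n\}$. A Boolean function $f:\{0,1\}^n\to\{0,1\}$ is called lexicographic if its support is an initial segment of $\{0,1\}^n$ listed in lexicographic order (starting from $0\cdots0$, or, reversed, from $1\cdots1$). Theorem. Let $\alpha>1$ and $n\ge 0$. There is $\delta=\delta(\alpha,n)\in(0,1/2)$ such that the following holds. (1) Weak noise. Let $m$ be the mean of some Boolean function on $\{0,1\}^n$. Then there is a lexicographic function of mean $m$, and for every $\epsilon\in[0,\delta]$ every lexicographic function of mean $m$ maximizes $\mathbb E(T_\epsilon f)^\alpha$ among all Boolean functions $f$ on $\{0,1\}^n$ with $\mathbb E f=m$. (2) Strong noise. Let $m$ be as in (1) and let $\epsilon\in[1/2-\delta,1/2)$. Among all Boolean functions $f$ on $\{0,1\}^n$ with $\mathbb E f=m$,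 the maximum of $\mathbb E(T_\epsilon f)^\alpha$ is attained at a function with the largest degree-1 Fourier weight $\sum_{i=1}^n\hat f(\{i\})^2$, and it is attained only at such functions. Moreover, every function of mean $m$ with the largest degree-1 weight has strictly larger $\mathbb E(T_\epsilon f)^\alpha$ than every function of mean $m$ whose degree-1 weight is not the largest. (Different functions with the same largest degree-1 weight may have different values of $\mathbb E(T_\epsilon f)^\alpha$.) (3) Balanced functions. For every $i\in\{1,\dots,n\}$ the dictator function $x\mapsto x_i$ is balanced, and for every $\epsilon\in[0,\delta]\cup[1/2-\delta,1/2]$ it maximizes $\mathbb E(T_\epsilon f)^\alpha$ among all balanced Boolean functions $f$ on $\{0,1\}^n$, i.e. those with $\mathbb P(f=0)=\mathbb P(f=1)$. -/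

import Mathlib

/-- The discrete cube `{0,1}^n`; addition is coordinatewise mod 2. -/
abbrev Cube (n : ℕ) : Type := Fin n → Fin 2

/-- Boolean functions on the cube. -/
abbrev BoolFun (n : ℕ) : Type := Cube n → Fin 2

namespace BoolFun

/-- A Boolean function regarded as a real-valued function. -/
def toReal {n : ℕ} (f : BoolFun n) : Cube n → ℝ := fun x => ((f x : ℕ) : ℝ)

end BoolFun

/-- Expectation with respect to the uniform measure on the cube. -/
noncomputable def cubeExp {n : ℕ} (g : Cube n → ℝ) : ℝ := (∑ x, g x) / 2 ^ n

/-- The probability that a vector with independent Bernoulli(`ε`) coordinates equals `z`. -/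
noncomputable def bernoulliWeight {n : ℕ} (ε : ℝ) (z : Cube n) : ℝ :=
  ∏ i, if z i = 1 then ε else 1 - ε

/-- The noise operator `T_ε g (x) = E g(x + Z)`, where `Z` has independent Bernoulli(`ε`)
coordinates. -/
noncomputable def noiseOp {n : ℕ} (ε : ℝ) (g : Cube n → ℝ) : Cube n → ℝ :=
  fun x => ∑ z, bernoulliWeight ε z * g (x + z)

/-- The Walsh function `W_A(x) = (-1)^(∑_{i ∈ A} x_i)`. -/
noncomputable def walsh {n : ℕ} (A : Finset (Fin n)) (x : Cube n) : ℝ :=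
  (-1) ^ (∑ i ∈ A, (x i : ℕ))

/-- The Fourier coefficient `E (g W_A)`. -/
noncomputable def cubeFourierCoeff {n : ℕ} (g : Cube n → ℝ) (A : Finset (Fin n)) : ℝ :=
  cubeExp fun x => g x * walsh A x

namespace BoolFun

/-- The mean `E f`. -/
noncomputable def mean {n : ℕ} (f : BoolFun n) : ℝ := cubeExp f.toReal

/-- The `α`-stability `E (T_ε f)^α`. -/
noncomputable def stability {n : ℕ} (α ε : ℝ) (f : BoolFun n) : ℝ :=
  cubeExp fun x => noiseOp ε f.toReal x ^ α

/-- The degree-1 Fourier weight. -/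
noncomputable def degOneWeight {n : ℕ} (f : BoolFun n) : ℝ :=
  ∑ i, cubeFourierCoeff f.toReal {i} ^ 2

/-- `f` has mean `m` and maximizes the `α`-stability among all Boolean functions of mean `m`. -/
def MaximizesStability {n : ℕ} (α ε m : ℝ) (f : BoolFun n) : Prop :=
  f.mean = m ∧ ∀ g : BoolFun n, g.mean = m → g.stability α ε ≤ f.stability α ε

/-- `f` has mean `m` and maximizes the degree-1 weight among all Boolean functions of mean `m`. -/
def MaximizesDegOneWeight {n : ℕ} (m : ℝ) (f : BoolFun n) : Prop :=
  f.mean = m ∧ ∀ g : BoolFun n, g.mean = m → g.degOneWeight ≤ f.degOneWeight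

/-- `f` is supported on a lexicographic set: the strings of the support are the first ones when
`{0,1}^n` is listed in the lexicographic order (first coordinate most significant). Both customary
directions of the list, the one starting at `0⋯0` and the one starting at `1⋯1`, are allowed. -/
def IsLexicographic {n : ℕ} (f : BoolFun n) : Prop :=
  (∀ x y : Cube n, toLex x ≤ toLex y → f y = 1 → f x = 1) ∨
    (∀ x y : Cube n, toLex y ≤ toLex x → f y = 1 → f x = 1)

/-- `P(f = 0) = P(f = 1)`. -/
def IsBalanced {n : ℕ} (f : BoolFun n) : Prop :=
  (Finset.univ.filter fun x => f x = 0).card = (Finset.univ.filter fun x => f x = 1).card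

/-- The dictator function of the `i`-th bit. -/
def dictator {n : ℕ} (i : Fin n) : BoolFun n := fun x => x i

end BoolFun

/-! Expand the stability at both ends of the noise range; only finitely many pairs of functions are
compared, so one `δ` serves them all.

At `ε = 0` all functions of mean `m` have stability `m`, and the derivative is an increasing
function of the number of edges spanned by the support (`hasDerivAt_stability_zero`). The most edges
a set of `k` points can span is `digitSumBelow k` (`spannedEdges_le`), and lexicographic sets attain
it. First order cannot separate two optimal sets, but it need not: optimal sets of equal size are
isometric (`IsEdgeOptimal.cubeIsometric`), so their stabilities agree for every `ε`.

At `ε = 1/2` the stability is `m ^ α`. The noise operator preserves the mean, so the first-order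
term cancels, and the second-order term is a positive multiple of the degree-1 weight when `0 < m`
(`tendsto_stability_half`). Larger weight then wins strictly.

For balanced functions the weight is at most `1/4`. Equality forces the support to be a half cube,
which is edge-optimal and hence isometric to the support of a dictator, so ties are harmless. -/

open Finset

/-! ### The edge-isoperimetric function -/

/-- The sum of the binary digit sums of the numbers below `m`. -/
def digitSumBelow (m : ℕ) : ℕ := ∑ k ∈ range m, (Nat.digits 2 k).sum

theorem sum_digits_two_mul (k : ℕ) : (Nat.digits 2 (2 * k)).sum = (Nat.digits 2 k).sum := by
  rcases Nat.eq_zero_or_pos k with rfl | h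
  · simp
  · rw [Nat.digits_def' (by norm_num) (by omega)]
    simp

theorem sum_digits_two_mul_add_one (k : ℕ) :
    (Nat.digits 2 (2 * k + 1)).sum = (Nat.digits 2 k).sum + 1 := by
  rw [Nat.digits_def' (by norm_num) (by omega), List.sum_cons,
    show (2 * k + 1) % 2 = 1 by omega, show (2 * k + 1) / 2 = k by omega, add_comm]

theorem digitSumBelow_succ (m : ℕ) :
    digitSumBelow (m + 1) = digitSumBelow m + (Nat.digits 2 m).sum := by
  simp [digitSumBelow, sum_range_succ]

@[simp] theorem digitSumBelow_zero : digitSumBelow 0 = 0 := by simp [digitSumBelow]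

theorem digitSumBelow_two_mul (m : ℕ) : digitSumBelow (2 * m) = 2 * digitSumBelow m + m := by
  induction m with
  | zero => simp
  | succ m ih =>
    rw [show 2 * (m + 1) = 2 * m + 1 + 1 by ring, digitSumBelow_succ, digitSumBelow_succ, ih,
      digitSumBelow_succ, sum_digits_two_mul, sum_digits_two_mul_add_one]
    ring

theorem digitSumBelow_two_mul_add_one (m : ℕ) :
    digitSumBelow (2 * m + 1) = digitSumBelow m + digitSumBelow (m + 1) + m := by
  rw [digitSumBelow_succ, digitSumBelow_two_mul, digitSumBelow_succ, sum_digits_two_mul]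
  ring

/-- Halve both numbers and use the recursions. An odd number splits into its two roundings, so with
an odd summand the induction hypothesis is needed for two pairs; if both are odd, opposite roundings
are paired. -/
theorem digitSumBelow_add_le (a b : ℕ) :
    digitSumBelow a + digitSumBelow b + min a b ≤ digitSumBelow (a + b) := by
  induction hs : a + b using Nat.strong_induction_on generalizing a b with
  | _ s ih =>
  subst hs
  rcases Nat.eq_zero_or_pos a with rfl | ha
  · simp
  rcases Nat.eq_zero_or_pos b with rfl | hb
  · simp
  rcases Nat.even_or_odd' a with ⟨a, rfl | rfl⟩ <;> rcases Nat.even_or_odd' b with ⟨b, rfl | rfl⟩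
  · have h := ih (a + b) (by omega) a b rfl
    rw [← mul_add]
    simp only [digitSumBelow_two_mul]
    omega
  · have h := ih (a + b) (by omega) a b rfl
    have h' := ih (a + (b + 1)) (by omega) a (b + 1) rfl
    rw [← add_assoc, ← mul_add]
    rw [← add_assoc] at h'
    simp only [digitSumBelow_two_mul, digitSumBelow_two_mul_add_one]
    omega
  · have h := ih (a + b) (by omega) a b rfl
    have h' := ih (a + 1 + b) (by omega) (a + 1) b rfl
    rw [show 2 * a + 1 + 2 * b = 2 * (a + b) + 1 by ring]
    rw [show a + 1 + b = a + b + 1 by ring] at h'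
    simp only [digitSumBelow_two_mul, digitSumBelow_two_mul_add_one]
    omega
  · have h := ih (a + 1 + b) (by omega) (a + 1) b rfl
    have h' := ih (a + (b + 1)) (by omega) a (b + 1) rfl
    rw [show 2 * a + 1 + (2 * b + 1) = 2 * (a + b + 1) by ring]
    rw [show a + 1 + b = a + b + 1 by ring] at h
    rw [← add_assoc] at h'
    simp only [digitSumBelow_two_mul, digitSumBelow_two_mul_add_one]
    omega

/-- The equality case of `digitSumBelow_add_le` met by a full facet together with a remainder in the
opposite facet. -/
theorem digitSumBelow_two_pow_add (k : ℕ) {r : ℕ} (hr : r ≤ 2 ^ k) :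
    digitSumBelow (2 ^ k + r) = digitSumBelow (2 ^ k) + digitSumBelow r + r := by
  induction k generalizing r with
  | zero =>
    rw [pow_zero] at hr ⊢
    interval_cases r
    · simp
    · simp [digitSumBelow, sum_range_succ]
  | succ k ih =>
    rw [pow_succ'] at hr ⊢
    rcases Nat.even_or_odd' r with ⟨r, rfl | rfl⟩
    · have h := ih (r := r) (by omega)
      rw [← mul_add]
      simp only [digitSumBelow_two_mul]
      omega
    · have h := ih (r := r) (by omega)
      have h' := ih (r := r + 1) (by omega)
      rw [← add_assoc, ← mul_add]
      rw [← add_assoc] at h'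
      simp only [digitSumBelow_two_mul, digitSumBelow_two_mul_add_one]
      omega

/-! ### Sections of a set and the edge bound -/

/-- Twice the number of edges of the cube spanned by `A`. -/
def spannedEdges {n : ℕ} (A : Finset (Cube n)) : ℕ :=
  ∑ i, #{x ∈ A | x + Pi.single i 1 ∈ A}

/-- The part of `A` where the `i`-th coordinate equals `c`, as a subset of a smaller cube. -/
def cubeSection {n : ℕ} (i : Fin (n + 1)) (c : Fin 2) (A : Finset (Cube (n + 1))) :
    Finset (Cube n) :=
  {y | (i.insertNth c y : Cube (n + 1)) ∈ A}

theorem mem_cubeSection {n : ℕ} {i : Fin (n + 1)} {c : Fin 2} {A : Finset (Cube (n + 1))}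
    {y : Cube n} : y ∈ cubeSection i c A ↔ (i.insertNth c y : Cube (n + 1)) ∈ A := by
  simp [cubeSection]

theorem fin_two_eq_or (c d : Fin 2) : d = c ∨ d = c + 1 := by
  revert c d; decide

theorem fin_two_ne_iff (c d : Fin 2) : d ≠ c ↔ d = c + 1 := by
  revert c d; decide

theorem fin_two_sum {M : Type*} [AddCommMonoid M] (g : Fin 2 → M) (c : Fin 2) :
    ∑ d, g d = g c + g (c + 1) := by
  rw [Fin.sum_univ_two]
  rcases fin_two_eq_or 0 c with rfl | rfl
  · rfl
  · rw [add_comm]; rfl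

theorem sum_cube_insertNth {M : Type*} [AddCommMonoid M] {n : ℕ} (i : Fin (n + 1)) (c : Fin 2)
    (g : Cube (n + 1) → M) :
    ∑ x, g x = ∑ y : Cube n, g (i.insertNth c y) + ∑ y : Cube n, g (i.insertNth (c + 1) y) := by
  rw [← (Fin.insertNthEquiv (fun _ => Fin 2) i).sum_comp, Fintype.sum_prod_type,
    fin_two_sum _ c]
  rfl

theorem insertNth_add_single_self {n : ℕ} (i : Fin (n + 1)) (c : Fin 2) (y : Cube n) :
    (i.insertNth c y : Cube (n + 1)) + Pi.single i 1 = i.insertNth (c + 1) y := by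
  ext j
  refine Fin.succAboveCases i ?_ (fun k => ?_) j
  · simp
  · simp

theorem insertNth_add_single_succAbove {n : ℕ} (i : Fin (n + 1)) (j : Fin n) (c : Fin 2)
    (y : Cube n) :
    (i.insertNth c y : Cube (n + 1)) + Pi.single (i.succAbove j) 1 =
      i.insertNth c (y + Pi.single j 1) := by
  ext k
  refine Fin.succAboveCases i ?_ (fun k => ?_) k
  · simp
  · simp [Pi.single_apply]

theorem card_eq_cubeSection {n : ℕ} (i : Fin (n + 1)) (c : Fin 2) (A : Finset (Cube (n + 1))) :
    #A = #(cubeSection i c A) + #(cubeSection i (c + 1) A) := by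
  have h := sum_cube_insertNth i c (fun x => if x ∈ A then 1 else 0)
  rw [← card_filter, ← card_filter, ← card_filter] at h
  simpa [cubeSection] using h

theorem spannedEdges_eq_sum {n : ℕ} (A : Finset (Cube n)) :
    spannedEdges A = ∑ i, ∑ x, if x ∈ A ∧ x + Pi.single i 1 ∈ A then 1 else 0 := by
  refine sum_congr rfl fun i _ => ?_
  rw [← card_filter]
  congr 1
  ext x
  simp

/-- Edges in direction `i` correspond to points common to both sections, and each is counted from
both ends. All other edges lie inside one section. -/
theorem spannedEdges_eq_cubeSection {n : ℕ} (i : Fin (n + 1)) (c : Fin 2)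
    (A : Finset (Cube (n + 1))) :
    spannedEdges A = spannedEdges (cubeSection i c A) + spannedEdges (cubeSection i (c + 1) A) +
      2 * #(cubeSection i c A ∩ cubeSection i (c + 1) A) := by
  have hc : c + 1 + 1 = c := by revert c; decide
  simp only [spannedEdges_eq_sum, Fin.sum_univ_succAbove _ i, sum_cube_insertNth i c,
    insertNth_add_single_self, insertNth_add_single_succAbove, sum_add_distrib, mem_cubeSection,
    hc]
  have h1 : (∑ y : Cube n, if (i.insertNth c y : Cube (n + 1)) ∈ A ∧
      (i.insertNth (c + 1) y : Cube (n + 1)) ∈ A then 1 else 0) =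
      #(cubeSection i c A ∩ cubeSection i (c + 1) A) := by
    rw [← card_filter]; congr 1; ext y; simp [mem_cubeSection]
  have h2 : (∑ y : Cube n, if (i.insertNth (c + 1) y : Cube (n + 1)) ∈ A ∧
      (i.insertNth c y : Cube (n + 1)) ∈ A then 1 else 0) =
      #(cubeSection i c A ∩ cubeSection i (c + 1) A) := by
    rw [← h1]; simp only [and_comm]
  rw [h1, h2]
  ring

theorem spannedEdges_le {n : ℕ} (A : Finset (Cube n)) : spannedEdges A ≤ 2 * digitSumBelow #A := by
  induction n with
  | zero => simp [spannedEdges]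
  | succ n ih =>
    rw [spannedEdges_eq_cubeSection 0 0, card_eq_cubeSection 0 0 A]
    have h0 := ih (cubeSection 0 0 A)
    have h1 := ih (cubeSection 0 (0 + 1) A)
    have h2 := digitSumBelow_add_le #(cubeSection 0 0 A) #(cubeSection 0 (0 + 1) A)
    have h3 := card_le_card (inter_subset_left : cubeSection 0 0 A ∩ cubeSection 0 (0 + 1) A ⊆ _)
    have h4 := card_le_card (inter_subset_right : cubeSection 0 0 A ∩ cubeSection 0 (0 + 1) A ⊆ _)
    omega

/-! ### Edge-optimal sets; lexicographic sets are optimal -/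

/-- `A` spans as many edges as possible for its size. -/
def IsEdgeOptimal {n : ℕ} (A : Finset (Cube n)) : Prop := spannedEdges A = 2 * digitSumBelow #A

theorem card_univ_cube (n : ℕ) : #(univ : Finset (Cube n)) = 2 ^ n := by simp

theorem card_cube_le {n : ℕ} (A : Finset (Cube n)) : #A ≤ 2 ^ n :=
  (card_le_univ A).trans (by simp)

theorem cubeSection_eq_empty_iff {n : ℕ} {i : Fin (n + 1)} {c : Fin 2}
    {A : Finset (Cube (n + 1))} : cubeSection i c A = ∅ ↔ ∀ x ∈ A, x i ≠ c := by
  constructor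
  · rintro h x hx rfl
    have : i.removeNth x ∈ cubeSection i (x i) A := by
      rw [mem_cubeSection, Fin.insertNth_self_removeNth]; exact hx
    simp [h] at this
  · intro h
    ext y
    simp only [mem_cubeSection, notMem_empty, iff_false]
    intro hy
    exact h _ hy (by simp)

theorem cubeSection_eq_univ_iff {n : ℕ} {i : Fin (n + 1)} {c : Fin 2}
    {A : Finset (Cube (n + 1))} : cubeSection i c A = univ ↔ ∀ x, x i = c → x ∈ A := by
  constructor
  · rintro h x rfl
    have : i.removeNth x ∈ cubeSection i (x i) A := by simp [h]
    rwa [mem_cubeSection, Fin.insertNth_self_removeNth] at this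
  · intro h
    ext y
    simp only [mem_cubeSection, mem_univ, iff_true]
    exact h _ (by simp)

theorem isEdgeOptimal_empty {n : ℕ} : IsEdgeOptimal (∅ : Finset (Cube n)) := by
  simp [IsEdgeOptimal, spannedEdges]

theorem IsEdgeOptimal.of_section_empty {n : ℕ} {i : Fin (n + 1)} {c : Fin 2}
    {A : Finset (Cube (n + 1))} (h : cubeSection i c A = ∅)
    (h' : IsEdgeOptimal (cubeSection i (c + 1) A)) : IsEdgeOptimal A := by
  unfold IsEdgeOptimal at *
  rw [spannedEdges_eq_cubeSection i c, card_eq_cubeSection i c A, h, h']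
  simp [spannedEdges]

theorem isEdgeOptimal_univ (n : ℕ) : IsEdgeOptimal (univ : Finset (Cube n)) := by
  induction n with
  | zero => simp [IsEdgeOptimal, spannedEdges, digitSumBelow]
  | succ n ih =>
    have hu (c : Fin 2) : cubeSection 0 c (univ : Finset (Cube (n + 1))) = univ :=
      cubeSection_eq_univ_iff.2 (by simp)
    unfold IsEdgeOptimal at *
    rw [spannedEdges_eq_cubeSection 0 0, card_eq_cubeSection 0 0 univ, hu, hu, ih]
    simp only [inter_self, card_univ_cube]
    rw [digitSumBelow_two_pow_add n le_rfl]
    ring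

theorem IsEdgeOptimal.of_section_univ {n : ℕ} {i : Fin (n + 1)} {c : Fin 2}
    {A : Finset (Cube (n + 1))} (h : cubeSection i c A = univ)
    (h' : IsEdgeOptimal (cubeSection i (c + 1) A)) : IsEdgeOptimal A := by
  have hu := isEdgeOptimal_univ n
  unfold IsEdgeOptimal at *
  rw [spannedEdges_eq_cubeSection i c, card_eq_cubeSection i c A, h, h', hu, univ_inter,
    card_univ_cube, digitSumBelow_two_pow_add n (card_cube_le _)]
  ring

theorem isEdgeOptimal_half {n : ℕ} (i : Fin n) (c : Fin 2) :
    IsEdgeOptimal ({x | x i = c} : Finset (Cube n)) := by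
  cases n with
  | zero => exact i.elim0
  | succ n =>
    refine IsEdgeOptimal.of_section_univ (i := i) (c := c)
      (cubeSection_eq_univ_iff.2 (by simp)) ?_
    rw [cubeSection_eq_empty_iff.2]
    · exact isEdgeOptimal_empty
    · have hc : c ≠ c + 1 := (fin_two_ne_iff (c + 1) c).2 (by revert c; decide)
      simp only [mem_filter, mem_univ, true_and]
      rintro x rfl
      exact hc

theorem toLex_cons_le_cons {n : ℕ} {a b : Fin 2} {x y : Cube n} :
    toLex (Fin.cons a x : Cube (n + 1)) ≤ toLex (Fin.cons b y : Cube (n + 1)) ↔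
      a < b ∨ a = b ∧ toLex x ≤ toLex y := by
  rw [le_iff_lt_or_eq, le_iff_lt_or_eq]
  have h1 : toLex (Fin.cons a x : Cube (n + 1)) < toLex (Fin.cons b y : Cube (n + 1)) ↔
      a < b ∨ a = b ∧ toLex x < toLex y := by
    exact Fin.pi_lex_lt_cons_cons (fun {_} => (· < ·))
  refine (or_congr h1 (by rw [EmbeddingLike.apply_eq_iff_eq, Fin.cons_inj])).trans ?_
  rw [EmbeddingLike.apply_eq_iff_eq]
  tauto

/-- Sections along the most significant coordinate are again initial segments. Unless the section at
`1` is empty, the section at `0` is full. -/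
theorem isEdgeOptimal_of_lex_isLowerSet {n : ℕ} {A : Finset (Cube n)}
    (hA : ∀ x y, toLex x ≤ toLex y → y ∈ A → x ∈ A) : IsEdgeOptimal A := by
  induction n with
  | zero =>
    rcases A.eq_empty_or_nonempty with rfl | ⟨x, hx⟩
    · exact isEdgeOptimal_empty
    · rw [show A = univ from eq_univ_of_forall fun y => Subsingleton.elim x y ▸ hx]
      exact isEdgeOptimal_univ 0
  | succ n ih =>
    have hs (c : Fin 2) : IsEdgeOptimal (cubeSection 0 c A) := ih fun x y hxy hy => by
      simp only [mem_cubeSection, Fin.insertNth_zero'] at hy ⊢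
      exact hA _ _ (toLex_cons_le_cons.2 (Or.inr ⟨rfl, hxy⟩)) hy
    rcases (cubeSection 0 1 A).eq_empty_or_nonempty with h | ⟨y, hy⟩
    · exact IsEdgeOptimal.of_section_empty h (hs _)
    · refine IsEdgeOptimal.of_section_univ (i := 0) (c := 0) ?_ (hs _)
      ext x
      simp only [mem_cubeSection, Fin.insertNth_zero', mem_univ, iff_true] at hy ⊢
      exact hA _ _ (toLex_cons_le_cons.2 (Or.inl (by decide))) hy

theorem isEdgeOptimal_of_lex_isUpperSet {n : ℕ} {A : Finset (Cube n)}
    (hA : ∀ x y, toLex y ≤ toLex x → y ∈ A → x ∈ A) : IsEdgeOptimal A := by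
  induction n with
  | zero =>
    rcases A.eq_empty_or_nonempty with rfl | ⟨x, hx⟩
    · exact isEdgeOptimal_empty
    · rw [show A = univ from eq_univ_of_forall fun y => Subsingleton.elim x y ▸ hx]
      exact isEdgeOptimal_univ 0
  | succ n ih =>
    have hs (c : Fin 2) : IsEdgeOptimal (cubeSection 0 c A) := ih fun x y hxy hy => by
      simp only [mem_cubeSection, Fin.insertNth_zero'] at hy ⊢
      exact hA _ _ (toLex_cons_le_cons.2 (Or.inr ⟨rfl, hxy⟩)) hy
    rcases (cubeSection 0 0 A).eq_empty_or_nonempty with h | ⟨y, hy⟩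
    · exact IsEdgeOptimal.of_section_empty h (hs _)
    · refine IsEdgeOptimal.of_section_univ (i := 0) (c := 1) ?_ (hs _)
      ext x
      simp only [mem_cubeSection, Fin.insertNth_zero', mem_univ, iff_true] at hy ⊢
      exact hA _ _ (toLex_cons_le_cons.2 (Or.inl (by decide))) hy

theorem exists_lex_isLowerSet {n k : ℕ} (hk : k ≤ 2 ^ n) :
    ∃ A : Finset (Cube n), #A = k ∧ ∀ x y, toLex x ≤ toLex y → y ∈ A → x ∈ A := by
  have hc : Fintype.card (Lex (Cube n)) = 2 ^ n := by
    rw [Fintype.card_lex]; simp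
  let e := Fintype.orderIsoFinOfCardEq (Lex (Cube n)) hc
  refine ⟨univ.filter fun x => (e.symm (toLex x) : ℕ) < k, ?_, fun x y hxy => ?_⟩
  · rw [← Fintype.card_subtype]
    have : Fintype.card {x : Cube n // (e.symm (toLex x) : ℕ) < k} =
        Fintype.card {a : Fin (2 ^ n) // (a : ℕ) < k} :=
      Fintype.card_congr ((toLex.trans e.symm.toEquiv).subtypeEquiv fun _ => Iff.rfl)
    rw [this, Fintype.card_congr (Fin.castLEquiv hk).symm, Fintype.card_fin]
  · rw [mem_filter, mem_filter]
    exact fun hy => ⟨mem_univ _, lt_of_le_of_lt (Fin.le_def.1 (e.symm.monotone hxy)) hy.2⟩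

/-! ### Rigidity of edge-optimal sets -/

/-- Inclusion–exclusion for `A` and its translate in each direction. Hence complementation changes
the edge count by an amount depending only on `#A`. -/
theorem spannedEdges_compl {n : ℕ} (A : Finset (Cube n)) :
    spannedEdges Aᶜ + 2 * n * #A = n * 2 ^ n + spannedEdges A := by
  have key (i : Fin n) : #{x ∈ Aᶜ | x + Pi.single i 1 ∈ Aᶜ} + 2 * #A =
      2 ^ n + #{x ∈ A | x + Pi.single i 1 ∈ A} := by
    have hB : #(univ.filter fun x : Cube n => x + Pi.single i 1 ∈ A) = #A := by
      rw [← card_map (Equiv.addRight (Pi.single i 1 : Cube n)).toEmbedding]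
      congr 1
      ext x
      simp [← sub_eq_add_neg]
    have h1 := card_union_add_card_inter A (univ.filter fun x : Cube n => x + Pi.single i 1 ∈ A)
    have h2 := card_compl_add_card (A ∪ univ.filter fun x : Cube n => x + Pi.single i 1 ∈ A)
    have h3 : {x ∈ Aᶜ | x + Pi.single i 1 ∈ Aᶜ} =
        (A ∪ univ.filter fun x : Cube n => x + Pi.single i 1 ∈ A)ᶜ := by
      ext x; simp
    have h4 : {x ∈ A | x + Pi.single i 1 ∈ A} =
        A ∩ univ.filter fun x : Cube n => x + Pi.single i 1 ∈ A := by
      ext x; simp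
    have h5 : Fintype.card (Cube n) = 2 ^ n := by simp
    rw [h3, h4]
    omega
  have h := sum_congr (rfl : (univ : Finset (Fin n)) = univ) fun i _ => key i
  simp only [sum_add_distrib, sum_const, card_univ, Fintype.card_fin, smul_eq_mul] at h
  unfold spannedEdges
  linarith

theorem IsEdgeOptimal.compl {n : ℕ} {A : Finset (Cube n)} (h : IsEdgeOptimal A) :
    IsEdgeOptimal Aᶜ := by
  refine (spannedEdges_le _).antisymm ?_
  obtain ⟨B, hB, hlex⟩ := exists_lex_isLowerSet (card_cube_le Aᶜ)
  have hBo := isEdgeOptimal_of_lex_isLowerSet hlex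
  unfold IsEdgeOptimal at h hBo
  have h1 := spannedEdges_compl A
  have h2 := spannedEdges_compl B
  have h3 := spannedEdges_le Bᶜ
  have hA : #Aᶜ + #A = 2 ^ n := by rw [card_compl_add_card]; simp
  have hB' : #Bᶜ = #A := by
    have : #Bᶜ + #B = 2 ^ n := by rw [card_compl_add_card]; simp
    omega
  rw [hB'] at h3
  rw [← hB, ← hBo]
  have h4 : 2 * n * #A + 2 * n * #B = 2 * (n * 2 ^ n) := by
    rw [← hA, hB]; ring
  omega

theorem cubeSection_compl {n : ℕ} (i : Fin (n + 1)) (c : Fin 2) (A : Finset (Cube (n + 1))) :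
    cubeSection i c Aᶜ = (cubeSection i c A)ᶜ := by
  ext y; simp [mem_cubeSection]

/-- The heart of uniqueness: a small optimal set lies in a facet. Equality in the proof of
`spannedEdges_le` makes the larger section optimal and the two sections nested, so an empty
subsection of the larger one is empty in both. -/
theorem IsEdgeOptimal.exists_section_eq_empty {n : ℕ} {A : Finset (Cube (n + 1))}
    (hA : IsEdgeOptimal A) (hcard : #A ≤ 2 ^ n) : ∃ i c, cubeSection i c A = ∅ := by
  induction n with
  | zero =>
    have h := card_eq_cubeSection 0 0 A
    rcases Nat.eq_zero_or_pos #(cubeSection 0 0 A) with h0 | h0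
    · exact ⟨0, 0, card_eq_zero.1 h0⟩
    · exact ⟨0, 0 + 1, card_eq_zero.1 (by rw [pow_zero] at hcard; omega)⟩
  | succ n ih =>
    obtain ⟨c, hc⟩ : ∃ c : Fin 2, #(cubeSection 0 (c + 1) A) ≤ #(cubeSection 0 c A) := by
      rcases le_total #(cubeSection 0 (0 + 1) A) #(cubeSection 0 0 A) with h | h
      · exact ⟨0, h⟩
      · exact ⟨1, h⟩
    have hE := spannedEdges_eq_cubeSection 0 c A
    have hN := card_eq_cubeSection 0 c A
    have hE0 := spannedEdges_le (cubeSection 0 c A)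
    have hE1 := spannedEdges_le (cubeSection 0 (c + 1) A)
    have hle := digitSumBelow_add_le #(cubeSection 0 c A) #(cubeSection 0 (c + 1) A)
    have hint := card_le_card
      (inter_subset_right : cubeSection 0 c A ∩ cubeSection 0 (c + 1) A ⊆ _)
    have hA' := hA
    unfold IsEdgeOptimal at hA
    rw [← hN] at hle
    have hB0 : IsEdgeOptimal (cubeSection 0 c A) := by unfold IsEdgeOptimal; omega
    have hsub : cubeSection 0 (c + 1) A ⊆ cubeSection 0 c A := by
      rw [← inter_eq_right]
      exact eq_of_subset_of_card_le inter_subset_right (by omega)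
    rw [inter_eq_right.2 hsub] at hE
    have hempty : ∀ {i d}, cubeSection i d (cubeSection 0 c A) = ∅ →
        ∃ i c, cubeSection i c A = ∅ := by
      intro i d h
      refine ⟨i.succ, d, ?_⟩
      rw [cubeSection_eq_empty_iff] at h ⊢
      intro x hx
      refine h (Fin.tail x) ?_
      have hx' : Fin.tail x ∈ cubeSection 0 (x 0) A := by
        rw [mem_cubeSection, Fin.insertNth_zero', Fin.cons_self_tail]; exact hx
      rcases fin_two_eq_or c (x 0) with h0 | h0
      · rwa [h0] at hx'
      · rw [h0] at hx'; exact hsub hx'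
    by_cases hsmall : #(cubeSection 0 c A) ≤ 2 ^ n
    · obtain ⟨i, d, h⟩ := ih hB0 hsmall
      exact hempty h
    -- Otherwise the larger section contains a full facet of its cube, by induction applied to its
    -- complement. Let `q > 0` be its remaining size and `p`, `t` the sizes of the two parts of the
    -- smaller section. The edge count falls short of the optimum for `2 ^ n + (p + t + q)` by at
    -- least `2 * min (p + t) q`, so `p + t = 0` and the smaller section is empty.
    · push Not at hsmall
      have hcompl : #(cubeSection 0 c A)ᶜ ≤ 2 ^ n := by
        have : #(cubeSection 0 c A)ᶜ + #(cubeSection 0 c A) = 2 ^ (n + 1) := by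
          rw [card_compl_add_card]; simp
        rw [pow_succ] at this
        omega
      obtain ⟨j, d, h⟩ := ih hB0.compl hcompl
      rw [cubeSection_compl, compl_eq_empty_iff] at h
      have hN0 := card_eq_cubeSection j d (cubeSection 0 c A)
      have hN1 := card_eq_cubeSection j d (cubeSection 0 (c + 1) A)
      have hF0 := spannedEdges_eq_cubeSection j d (cubeSection 0 c A)
      have hF1 := spannedEdges_eq_cubeSection j d (cubeSection 0 (c + 1) A)
      have hu := isEdgeOptimal_univ n
      unfold IsEdgeOptimal at hu
      rw [h, card_univ_cube] at hN0
      rw [h, univ_inter, hu, card_univ_cube] at hF0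
      have hQ := spannedEdges_le (cubeSection j (d + 1) (cubeSection 0 c A))
      have hP := spannedEdges_le (cubeSection j d (cubeSection 0 (c + 1) A))
      have hT := spannedEdges_le (cubeSection j (d + 1) (cubeSection 0 (c + 1) A))
      have hi1 := card_le_card (inter_subset_left : cubeSection j d (cubeSection 0 (c + 1) A) ∩
        cubeSection j (d + 1) (cubeSection 0 (c + 1) A) ⊆ _)
      have hi2 := card_le_card (inter_subset_right : cubeSection j d (cubeSection 0 (c + 1) A) ∩
        cubeSection j (d + 1) (cubeSection 0 (c + 1) A) ⊆ _)
      set q := #(cubeSection j (d + 1) (cubeSection 0 c A))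
      set p := #(cubeSection j d (cubeSection 0 (c + 1) A))
      set t := #(cubeSection j (d + 1) (cubeSection 0 (c + 1) A))
      have hAn : #A = 2 ^ n + (p + t + q) := by omega
      have hr : p + t + q ≤ 2 ^ n := by rw [pow_succ] at hcard; omega
      have hs := digitSumBelow_two_pow_add n hr
      rw [← hAn] at hs
      have hs1 := digitSumBelow_add_le (p + t) q
      have hs2 := digitSumBelow_add_le p t
      exact ⟨0, c + 1, card_eq_zero.1 (by omega)⟩

theorem IsEdgeOptimal.exists_section_eq_univ {n : ℕ} {A : Finset (Cube (n + 1))}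
    (hA : IsEdgeOptimal A) (hcard : 2 ^ n ≤ #A) : ∃ i c, cubeSection i c A = univ := by
  have h : #Aᶜ + #A = 2 ^ (n + 1) := by rw [card_compl_add_card]; simp
  rw [pow_succ] at h
  obtain ⟨i, c, hic⟩ := hA.compl.exists_section_eq_empty (by omega)
  exact ⟨i, c, by rwa [cubeSection_compl, compl_eq_empty_iff] at hic⟩

/-- Some isometry of the cube maps `A` onto `B`. -/
def CubeIsometric {n : ℕ} (A B : Finset (Cube n)) : Prop :=
  ∃ φ : Cube n ≃ Cube n, (∀ x y, hammingDist (φ x) (φ y) = hammingDist x y) ∧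
    ∀ x, x ∈ A ↔ φ x ∈ B

theorem hammingDist_insertNth {n : ℕ} (i : Fin (n + 1)) (c d : Fin 2) (x y : Cube n) :
    hammingDist (i.insertNth c x : Cube (n + 1)) (i.insertNth d y) =
      (if c ≠ d then 1 else 0) + hammingDist x y := by
  simp only [hammingDist, card_filter, Fin.sum_univ_succAbove _ i, Fin.insertNth_apply_same,
    Fin.insertNth_apply_succAbove]

theorem cubeIsometric_of_sections {n : ℕ} {A B : Finset (Cube (n + 1))} {i j : Fin (n + 1)}
    {c d : Fin 2} (h : CubeIsometric (cubeSection i c A) (cubeSection j d B))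
    (h' : cubeSection i (c + 1) A = ∅ ∧ cubeSection j (d + 1) B = ∅ ∨
      cubeSection i (c + 1) A = univ ∧ cubeSection j (d + 1) B = univ) : CubeIsometric A B := by
  obtain ⟨ψ, hψ, hAB⟩ := h
  have hAB' (y : Cube n) : y ∈ cubeSection i (c + 1) A ↔ ψ y ∈ cubeSection j (d + 1) B := by
    rcases h' with ⟨h1, h2⟩ | ⟨h1, h2⟩ <;> simp [h1, h2]
  -- Coordinate `i` is moved to position `j` and shifted by `d - c`, which sends the value `c` to
  -- `d`; `ψ` acts on the rest.
  refine ⟨(Fin.insertNthEquiv (fun _ => Fin 2) i).symm.trans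
    (((Equiv.addRight (d - c)).prodCongr ψ).trans (Fin.insertNthEquiv (fun _ => Fin 2) j)),
    fun x y => ?_, fun x => ?_⟩
  · obtain ⟨⟨a, x⟩, rfl⟩ := (Fin.insertNthEquiv (fun _ => Fin 2) i).surjective x
    obtain ⟨⟨b, y⟩, rfl⟩ := (Fin.insertNthEquiv (fun _ => Fin 2) i).surjective y
    simp only [Equiv.trans_apply, Equiv.symm_apply_apply, Equiv.prodCongr_apply, Prod.map,
      Equiv.coe_addRight]
    change hammingDist (j.insertNth (a + (d - c)) (ψ x) : Cube (n + 1))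
      (j.insertNth (b + (d - c)) (ψ y)) =
        hammingDist (i.insertNth a x : Cube (n + 1)) (i.insertNth b y)
    rw [hammingDist_insertNth, hammingDist_insertNth, hψ]
    simp
  · obtain ⟨⟨a, x⟩, rfl⟩ := (Fin.insertNthEquiv (fun _ => Fin 2) i).surjective x
    simp only [Equiv.trans_apply, Equiv.symm_apply_apply, Equiv.prodCongr_apply, Prod.map,
      Equiv.coe_addRight]
    change (i.insertNth a x : Cube (n + 1)) ∈ A ↔
      (j.insertNth (a + (d - c)) (ψ x) : Cube (n + 1)) ∈ B
    simp only [mem_cubeSection] at hAB hAB'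
    rcases fin_two_eq_or c a with rfl | rfl
    · rw [hAB]; simp
    · have hcd : ∀ c d : Fin 2, c + 1 + (d - c) = d + 1 := by decide
      rw [hAB', hcd]

/-- Both sets lie in a facet or both contain one, according to their size. The opposite sections are
again optimal of equal size, so induction on the dimension applies. -/
theorem IsEdgeOptimal.cubeIsometric {n : ℕ} {A B : Finset (Cube n)} (hA : IsEdgeOptimal A)
    (hB : IsEdgeOptimal B) (h : #A = #B) : CubeIsometric A B := by
  have hcc (c : Fin 2) : c + 1 + 1 = c := by revert c; decide
  induction n with
  | zero =>
    refine ⟨Equiv.refl _, fun _ _ => rfl, fun x => ?_⟩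
    have hx (C : Finset (Cube 0)) : x ∈ C ↔ 0 < #C :=
      ⟨fun hx => card_pos.2 ⟨x, hx⟩, fun hC => by
        obtain ⟨y, hy⟩ := card_pos.1 hC
        exact Subsingleton.elim y x ▸ hy⟩
    rw [Equiv.refl_apply, hx, hx, h]
  | succ n ih =>
    rcases le_total #A (2 ^ n) with hn | hn
    · obtain ⟨i, c, hi⟩ := hA.exists_section_eq_empty hn
      obtain ⟨j, d, hj⟩ := hB.exists_section_eq_empty (h ▸ hn)
      refine cubeIsometric_of_sections (i := i) (j := j) (c := c + 1) (d := d + 1) ?_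
        (Or.inl (by rw [hcc, hcc]; exact ⟨hi, hj⟩))
      unfold IsEdgeOptimal at hA hB
      rw [spannedEdges_eq_cubeSection i c, card_eq_cubeSection i c A, hi] at hA
      rw [spannedEdges_eq_cubeSection j d, card_eq_cubeSection j d B, hj] at hB
      rw [card_eq_cubeSection i c A, card_eq_cubeSection j d B, hi, hj] at h
      simp only [spannedEdges, notMem_empty, empty_inter, card_empty, filter_empty, sum_const_zero,
        zero_add, mul_zero, add_zero] at hA hB h
      exact ih hA hB h
    · obtain ⟨i, c, hi⟩ := hA.exists_section_eq_univ hn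
      obtain ⟨j, d, hj⟩ := hB.exists_section_eq_univ (h ▸ hn)
      refine cubeIsometric_of_sections (i := i) (j := j) (c := c + 1) (d := d + 1) ?_
        (Or.inr (by rw [hcc, hcc]; exact ⟨hi, hj⟩))
      have hu := isEdgeOptimal_univ n
      unfold IsEdgeOptimal at hA hB hu
      rw [spannedEdges_eq_cubeSection i c, card_eq_cubeSection i c A, hi, hu, card_univ_cube,
        digitSumBelow_two_pow_add n (card_cube_le _), univ_inter] at hA
      rw [spannedEdges_eq_cubeSection j d, card_eq_cubeSection j d B, hj, hu, card_univ_cube,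
        digitSumBelow_two_pow_add n (card_cube_le _), univ_inter] at hB
      rw [card_eq_cubeSection i c A, card_eq_cubeSection j d B, hi, hj] at h
      exact ih (by unfold IsEdgeOptimal; omega) (by unfold IsEdgeOptimal; omega) (by omega)

/-! ### Boolean functions and invariance of stability under isometries -/

open Filter Topology

namespace BoolFun

/-- The set of points where `f` equals `1`. -/
def supp {n : ℕ} (f : BoolFun n) : Finset (Cube n) := {x | f x = 1}

theorem mem_supp {n : ℕ} {f : BoolFun n} {x : Cube n} : x ∈ f.supp ↔ f x = 1 := by simp [supp]

theorem toReal_eq_ite {n : ℕ} (f : BoolFun n) (x : Cube n) :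
    f.toReal x = if x ∈ f.supp then 1 else 0 := by
  rw [toReal]
  by_cases h : f x = 1
  · simp [mem_supp, h]
  · have h0 : f x = 0 := by
      generalize f x = c at h ⊢; revert c; decide
    simp [mem_supp, h0]

theorem mean_eq_card {n : ℕ} (f : BoolFun n) : f.mean = #f.supp / 2 ^ n := by
  simp [mean, cubeExp, toReal_eq_ite]

theorem card_supp_eq_of_mean_eq {n : ℕ} {f g : BoolFun n} (h : f.mean = g.mean) :
    #f.supp = #g.supp := by
  rw [mean_eq_card, mean_eq_card, div_left_inj' (by positivity)] at h
  exact_mod_cast h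

theorem isBalanced_iff {n : ℕ} (f : BoolFun n) : f.IsBalanced ↔ f.mean = 1 / 2 := by
  have h0 : (univ.filter fun x => f x = 0) = f.suppᶜ := by
    ext x
    simp only [mem_filter, mem_univ, true_and, mem_compl, mem_supp]
    generalize f x = c; revert c; decide
  have h1 : #f.suppᶜ + #f.supp = 2 ^ n := by rw [card_compl_add_card]; simp
  rw [IsBalanced, h0, mean_eq_card, div_eq_div_iff (by positivity) (by norm_num)]
  change #f.suppᶜ = #f.supp ↔ _
  rw [one_mul]
  norm_cast
  omega

end BoolFun

theorem bernoulliWeight_eq_pow {n : ℕ} (ε : ℝ) (z : Cube n) :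
    bernoulliWeight ε z = ε ^ hammingNorm z * (1 - ε) ^ (n - hammingNorm z) := by
  have h (c : Fin 2) : c = 1 ↔ c ≠ 0 := by revert c; decide
  simp only [bernoulliWeight, h]
  rw [prod_ite, prod_const, prod_const]
  have := card_filter_add_card_filter_not (s := (univ : Finset (Fin n))) (fun i => z i ≠ 0)
  rw [card_univ, Fintype.card_fin] at this
  rw [hammingNorm, show #{i | ¬z i ≠ 0} = n - #{i | z i ≠ 0} by omega]

theorem noiseOp_eq_sum_sub {n : ℕ} (ε : ℝ) (g : Cube n → ℝ) (x : Cube n) :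
    noiseOp ε g x = ∑ y, bernoulliWeight ε (y - x) * g y := by
  rw [noiseOp, ← Equiv.sum_comp (Equiv.addLeft x) fun y => _ * g y]
  simp

/-- The kernel of the noise operator depends only on the Hamming distance. -/
theorem CubeIsometric.stability_eq {n : ℕ} {f g : BoolFun n} (h : CubeIsometric f.supp g.supp)
    (α ε : ℝ) : f.stability α ε = g.stability α ε := by
  obtain ⟨φ, hφ, hfg⟩ := h
  have hT (x : Cube n) : noiseOp ε f.toReal x = noiseOp ε g.toReal (φ x) := by
    rw [noiseOp_eq_sum_sub, noiseOp_eq_sum_sub, ← Equiv.sum_comp φ fun y => _ * g.toReal y]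
    refine sum_congr rfl fun y _ => ?_
    rw [bernoulliWeight_eq_pow, bernoulliWeight_eq_pow, ← neg_add_eq_sub x,
      ← neg_add_eq_sub (φ x), ← hammingDist_eq_hammingNorm,
      ← hammingDist_eq_hammingNorm, hφ, BoolFun.toReal_eq_ite, BoolFun.toReal_eq_ite]
    simp only [hfg]
  rw [BoolFun.stability, BoolFun.stability, cubeExp, cubeExp,
    ← Equiv.sum_comp φ fun x => noiseOp ε g.toReal x ^ α]
  simp only [hT]

/-! ### First-order expansion at zero noise -/

theorem hasDerivAt_bernoulliWeight {n : ℕ} (ε : ℝ) (z : Cube n) :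
    HasDerivAt (fun ε => bernoulliWeight ε z)
      (∑ i, (∏ j ∈ univ.erase i, if z j = 1 then ε else 1 - ε) *
        (if z i = 1 then (1 : ℝ) else -1)) ε := by
  unfold bernoulliWeight
  refine HasDerivAt.fun_finsetProd (u := univ) (f := fun i ε => if z i = 1 then ε else 1 - ε)
    fun i _ => ?_
  by_cases h : z i = 1
  · simpa [h] using hasDerivAt_id' ε
  · simpa [h] using (hasDerivAt_id ε).const_sub 1

theorem hasDerivAt_noiseOp {n : ℕ} (ε : ℝ) (g : Cube n → ℝ) (x : Cube n) :
    HasDerivAt (fun ε => noiseOp ε g x)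
      (∑ i, ∑ z, (∏ j ∈ univ.erase i, if z j = 1 then ε else 1 - ε) *
        (if z i = 1 then (1 : ℝ) else -1) * g (x + z)) ε := by
  rw [sum_comm]
  simp only [← sum_mul]
  exact HasDerivAt.fun_sum fun z _ => (hasDerivAt_bernoulliWeight ε z).mul_const _

theorem bernoulliWeight_zero {n : ℕ} (z : Cube n) :
    bernoulliWeight 0 z = if z = 0 then 1 else 0 := by
  rw [bernoulliWeight_eq_pow]
  simp [zero_pow_eq]

theorem noiseOp_zero {n : ℕ} (g : Cube n → ℝ) (x : Cube n) : noiseOp 0 g x = g x := by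
  simp [noiseOp, bernoulliWeight_zero]

theorem hasDerivAt_noiseOp_zero {n : ℕ} (g : Cube n → ℝ) (x : Cube n) :
    HasDerivAt (fun ε => noiseOp ε g x) (∑ i, (g (x + Pi.single i 1) - g x)) 0 := by
  convert hasDerivAt_noiseOp 0 g x using 1
  refine sum_congr rfl fun i _ => ?_
  have hne : (Pi.single i 1 : Cube n) ≠ 0 := by simp
  -- At `ε = 0` the product over `j ≠ i` vanishes unless `z` is `0` or the `i`-th unit vector.
  rw [Fintype.sum_eq_add _ _ hne]
  · have h1 : ∏ j ∈ univ.erase i, (if (Pi.single i 1 : Cube n) j = 1 then (0 : ℝ) else 1 - 0) = 1 :=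
      prod_eq_one fun j hj => by simp [ne_of_mem_erase hj]
    rw [h1]
    simp
    ring
  · rintro z ⟨hz1, hz0⟩
    obtain ⟨j, hji, hj⟩ : ∃ j, j ≠ i ∧ z j = 1 := by
      by_contra! hcon
      have hj (j : Fin n) (hj : j ≠ i) : z j = 0 := by
        have := hcon j hj
        generalize z j = c at this; revert c; decide
      rcases fin_two_eq_or 0 (z i) with h | h
      · refine hz0 (funext fun j => ?_)
        by_cases hji : j = i
        · rw [hji, h]; rfl
        · rw [hj j hji]; rfl
      · refine hz1 (funext fun j => ?_)
        by_cases hji : j = i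
        · rw [hji, h]; simp
        · rw [hj j hji]; simp [hji]
    rw [prod_eq_zero (mem_erase.2 ⟨hji, mem_univ j⟩) (by simp [hj])]
    simp

/-- Since `α > 1`, the factor `f ^ (α - 1)` is the indicator of the support, so only the loss at
points of the support counts: one unit per neighbour outside it. -/
theorem hasDerivAt_stability_zero {n : ℕ} {α : ℝ} (hα : 1 < α) (f : BoolFun n) :
    HasDerivAt (fun ε => f.stability α ε)
      (α * (spannedEdges f.supp - n * #f.supp) / 2 ^ n) 0 := by
  have h := (HasDerivAt.fun_sum (u := univ) fun x _ =>
    (hasDerivAt_noiseOp_zero f.toReal x).rpow_const (p := α) (Or.inr hα.le)).div_const (2 ^ n)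
  refine h.congr_deriv ?_
  simp only [noiseOp_zero]
  have hx (x : Cube n) : (∑ i, (f.toReal (x + Pi.single i 1) - f.toReal x)) * α *
      f.toReal x ^ (α - 1) =
      α * (∑ i, ((if x ∈ f.supp ∧ x + Pi.single i 1 ∈ f.supp then 1 else 0) -
        if x ∈ f.supp then (1 : ℝ) else 0)) := by
    simp only [BoolFun.toReal_eq_ite]
    by_cases h : x ∈ f.supp
    · simp [h]; ring
    · simp [h, Real.zero_rpow (sub_ne_zero.2 hα.ne')]
  simp only [hx]
  rw [← mul_sum, sum_comm, spannedEdges_eq_sum]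
  simp [sum_sub_distrib]

theorem BoolFun.stability_zero {n : ℕ} {α : ℝ} (hα : 1 < α) (f : BoolFun n) :
    f.stability α 0 = f.mean := by
  unfold BoolFun.stability BoolFun.mean
  simp only [noiseOp_zero]
  congr 1
  ext x
  rw [BoolFun.toReal_eq_ite]
  split_ifs
  · simp
  · simp [Real.zero_rpow (by linarith : α ≠ 0)]

theorem eventually_stability_lt_of_spannedEdges_lt {n : ℕ} {α : ℝ} (hα : 1 < α) {f g : BoolFun n}
    (hfg : f.mean = g.mean) (hE : spannedEdges g.supp < spannedEdges f.supp) :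
    ∀ᶠ ε in 𝓝[>] (0 : ℝ), g.stability α ε < f.stability α ε := by
  have h := (hasDerivAt_stability_zero hα f).sub (hasDerivAt_stability_zero hα g)
  rw [← BoolFun.card_supp_eq_of_mean_eq hfg] at h
  have hpos : 0 < α * (spannedEdges f.supp - n * #f.supp) / 2 ^ n -
      α * (spannedEdges g.supp - n * #f.supp : ℝ) / 2 ^ n := by
    rw [← sub_div, ← mul_sub]
    have : (spannedEdges g.supp : ℝ) < spannedEdges f.supp := by exact_mod_cast hE
    exact div_pos (mul_pos (by linarith) (by linarith)) (by positivity)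
  have ht := (hasDerivAt_iff_tendsto_slope.1 h).mono_left
    (nhdsWithin_mono 0 (fun x (hx : 0 < x) => hx.ne') : 𝓝[>] (0 : ℝ) ≤ 𝓝[≠] 0)
  filter_upwards [ht.eventually (lt_mem_nhds hpos), self_mem_nhdsWithin] with ε hε hε0
  rw [slope_def_field, sub_zero] at hε
  have := (div_pos_iff_of_pos_right hε0).1 hε
  simp only [Pi.sub_apply, BoolFun.stability_zero hα, hfg] at this
  linarith

/-! ### Second-order expansion at noise 1/2 -/

theorem sum_bernoulliWeight {n : ℕ} (ε : ℝ) : ∑ z : Cube n, bernoulliWeight ε z = 1 := by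
  simp only [bernoulliWeight]
  rw [← Fintype.prod_sum (fun (_ : Fin n) (c : Fin 2) => if c = 1 then ε else 1 - ε)]
  simp

theorem cubeExp_noiseOp {n : ℕ} (ε : ℝ) (g : Cube n → ℝ) :
    cubeExp (noiseOp ε g) = cubeExp g := by
  unfold cubeExp noiseOp
  rw [sum_comm]
  have (z : Cube n) : ∑ x, bernoulliWeight ε z * g (x + z) = bernoulliWeight ε z * ∑ x, g x := by
    rw [← mul_sum, ← Equiv.sum_comp (Equiv.addRight z) g]
    rfl
  simp only [this]
  rw [← sum_mul, sum_bernoulliWeight, one_mul]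

theorem walsh_singleton {n : ℕ} (i : Fin n) (x : Cube n) :
    walsh {i} x = if x i = 1 then -1 else 1 := by
  rw [walsh, sum_singleton]
  rcases fin_two_eq_or 0 (x i) with h | h <;> simp [h]

theorem walsh_singleton_mul_self {n : ℕ} (i : Fin n) (x : Cube n) :
    walsh {i} x * walsh {i} x = 1 := by
  rw [walsh_singleton]; split_ifs <;> norm_num

theorem walsh_singleton_add {n : ℕ} (i : Fin n) (x y : Cube n) :
    walsh {i} (x + y) = walsh {i} x * walsh {i} y := by
  have h (a b : Fin 2) : a + b = 1 ↔ ¬(a = 1 ↔ b = 1) := by revert a b; decide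
  simp only [walsh_singleton, Pi.add_apply, h]
  split_ifs <;> simp_all

theorem walsh_singleton_single {n : ℕ} (i j : Fin n) :
    walsh {j} (Pi.single i 1 : Cube n) = if i = j then -1 else 1 := by
  rw [walsh_singleton]
  by_cases h : i = j
  · simp [h]
  · simp [h, Ne.symm h]

theorem sum_eq_zero_of_add_single {n : ℕ} {g : Cube n → ℝ} (i : Fin n)
    (h : ∀ x, g (x + Pi.single i 1) = -g x) : ∑ x, g x = 0 := by
  have h1 := Equiv.sum_comp (Equiv.addRight (Pi.single i 1 : Cube n)) g
  simp only [Equiv.coe_addRight, h, sum_neg_distrib] at h1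
  linarith

theorem sum_walsh_singleton {n : ℕ} (i : Fin n) : ∑ x : Cube n, walsh {i} x = 0 :=
  sum_eq_zero_of_add_single i fun x => by
    rw [walsh_singleton_add, walsh_singleton_single]; simp

theorem sum_walsh_singleton_mul {n : ℕ} (i j : Fin n) :
    ∑ x : Cube n, walsh {i} x * walsh {j} x = if i = j then 2 ^ n else 0 := by
  split_ifs with h
  · subst h
    simp [walsh_singleton_mul_self]
  · refine sum_eq_zero_of_add_single i fun x => ?_
    simp [walsh_singleton_add, walsh_singleton_single, h]

theorem cubeExp_sq_sum_walsh {n : ℕ} (c : Fin n → ℝ) :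
    cubeExp (fun x => (∑ i, c i * walsh {i} x) ^ 2) = ∑ i, c i ^ 2 := by
  rw [cubeExp, div_eq_iff (by positivity)]
  simp only [sq, sum_mul_sum]
  rw [sum_comm, sum_mul]
  refine sum_congr rfl fun i _ => ?_
  rw [sum_comm]
  have (j : Fin n) : ∑ x : Cube n, c i * walsh {i} x * (c j * walsh {j} x) =
      c i * c j * if i = j then 2 ^ n else 0 := by
    rw [← sum_walsh_singleton_mul, mul_sum]
    exact sum_congr rfl fun x _ => by ring
  simp [this]

theorem bernoulliWeight_half {n : ℕ} (z : Cube n) : bernoulliWeight (1 / 2) z = 1 / 2 ^ n := by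
  have h : (1 : ℝ) - 1 / 2 = 1 / 2 := by norm_num
  simp only [bernoulliWeight, h, ite_self]
  simp

theorem noiseOp_half {n : ℕ} (g : Cube n → ℝ) (x : Cube n) : noiseOp (1 / 2) g x = cubeExp g := by
  simp only [noiseOp, bernoulliWeight_half, cubeExp]
  rw [← mul_sum, ← Equiv.sum_comp (Equiv.addLeft x) g]
  simp only [Equiv.coe_addLeft]
  ring

theorem hasDerivAt_noiseOp_half {n : ℕ} (g : Cube n → ℝ) (x : Cube n) :
    HasDerivAt (fun ε => noiseOp ε g x)
      (∑ i, (-2 * cubeFourierCoeff g {i}) * walsh {i} x) (1 / 2) := by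
  convert hasDerivAt_noiseOp (1 / 2) g x using 1
  refine sum_congr rfl fun i _ => ?_
  have h : (1 : ℝ) - 1 / 2 = 1 / 2 := by norm_num
  have hs (z : Cube n) : (if z i = 1 then (1 : ℝ) else -1) = -walsh {i} x * walsh {i} (x + z) := by
    rw [walsh_singleton_add, neg_mul, ← mul_assoc, walsh_singleton_mul_self, walsh_singleton]
    split_ifs <;> norm_num
  have hp : ((1 : ℝ) / 2) ^ (n - 1) = 2 / 2 ^ n := by
    obtain ⟨k, rfl⟩ : ∃ k, n = k + 1 := ⟨n - 1, by have := i.pos; omega⟩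
    rw [Nat.add_sub_cancel, pow_succ, one_div, inv_pow]
    field_simp
  simp only [h, ite_self, prod_const, card_erase_of_mem (mem_univ i), card_univ, Fintype.card_fin,
    hp, hs]
  rw [cubeFourierCoeff, cubeExp,
    ← Equiv.sum_comp (Equiv.addLeft x) fun z => g z * walsh {i} z, sum_div, mul_sum, sum_mul]
  exact sum_congr rfl fun z _ => by simp only [Equiv.coe_addLeft]; ring

/-- The derivative of the remainder is the first-order remainder of `α * t ^ (α - 1)`, hence `o(t -
m)`; integrating gains one order. -/
theorem isLittleO_rpow_sub_taylor {m : ℝ} (hm : 0 < m) (α : ℝ) :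
    (fun t : ℝ => t ^ α - m ^ α - α * m ^ (α - 1) * (t - m) -
      α * (α - 1) / 2 * m ^ (α - 2) * (t - m) ^ 2) =o[𝓝 m] fun t => (t - m) ^ 2 := by
  have hd (t : ℝ) (ht : t ∈ Set.Ioi (0 : ℝ)) : HasDerivWithinAt
      (fun t : ℝ => t ^ α - m ^ α - α * m ^ (α - 1) * (t - m) -
        α * (α - 1) / 2 * m ^ (α - 2) * (t - m) ^ 2)
      (α * t ^ (α - 1) - α * m ^ (α - 1) - α * (α - 1) * m ^ (α - 2) * (t - m))
      (Set.Ioi 0) t := by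
    have h1 := Real.hasDerivAt_rpow_const (p := α) (Or.inl (ne_of_gt ht) : t ≠ 0 ∨ 1 ≤ α)
    have h2 := (hasDerivAt_id t).sub_const m
    have h3 := ((h1.sub_const (m ^ α)).sub (h2.const_mul (α * m ^ (α - 1)))).sub
      ((h2.pow 2).const_mul (α * (α - 1) / 2 * m ^ (α - 2)))
    refine HasDerivAt.hasDerivWithinAt ?_
    convert! h3 using 1
    simp
    ring
  have ho := (convex_Ioi (0 : ℝ)).isLittleO_pow_succ_real (n := 1) hm hd ?_
  · rw [isOpen_Ioi.nhdsWithin_eq hm] at ho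
    simpa using ho
  · rw [isOpen_Ioi.nhdsWithin_eq hm]
    have h1 := (Real.hasDerivAt_rpow_const (p := α - 1)
      (Or.inl hm.ne' : m ≠ 0 ∨ 1 ≤ α - 1)).const_mul α
    have h2 := h1.isLittleO
    refine (h2.congr (fun t => ?_) fun t => ?_)
    · rw [show α - 1 - 1 = α - 2 by ring]; simp; ring
    · simp

theorem tendsto_rpow_second_order {T : ℝ → ℝ} {T' a m : ℝ} (hm : 0 < m) (α : ℝ) (hTa : T a = m)
    (hT : HasDerivAt T T' a) :
    Tendsto (fun ε => (T ε ^ α - m ^ α - α * m ^ (α - 1) * (T ε - m)) / (ε - a) ^ 2) (𝓝[≠] a)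
      (𝓝 (α * (α - 1) / 2 * m ^ (α - 2) * T' ^ 2)) := by
  have hc : Tendsto T (𝓝 a) (𝓝 m) := hTa ▸ hT.continuousAt
  have ho := (isLittleO_rpow_sub_taylor hm α).comp_tendsto hc
  have hO : (fun ε => (T ε - m) ^ 2) =O[𝓝 a] fun ε => (ε - a) ^ 2 := by
    have := hT.isBigO_sub
    rw [hTa] at this
    exact this.pow 2
  have h1 := ((ho.trans_isBigO hO).mono (nhdsWithin_le_nhds (s := {a}ᶜ))).tendsto_div_nhds_zero
  have h2 := ((hasDerivAt_iff_tendsto_slope.1 hT).pow 2).const_mul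
    (α * (α - 1) / 2 * m ^ (α - 2))
  have h3 := h1.add h2
  rw [zero_add] at h3
  refine h3.congr fun ε => ?_
  simp only [Function.comp, slope_def_field, hTa, div_pow]
  ring

/-- Averaged over `x`, the linear Taylor term vanishes by `cubeExp_noiseOp`, and orthogonality of
the Walsh functions turns the quadratic term into the degree-1 weight. -/
theorem tendsto_stability_half {n : ℕ} (α : ℝ) (f : BoolFun n) (hm : 0 < f.mean) :
    Tendsto (fun ε => (f.stability α ε - f.mean ^ α) / (ε - 1 / 2) ^ 2) (𝓝[≠] (1 / 2))
      (𝓝 (2 * α * (α - 1) * f.mean ^ (α - 2) * f.degOneWeight)) := by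
  have h := (tendsto_finsetSum univ fun x _ => tendsto_rpow_second_order hm α
    (noiseOp_half f.toReal x) (hasDerivAt_noiseOp_half f.toReal x)).div_const (2 ^ n)
  have hW := cubeExp_sq_sum_walsh fun i => -2 * cubeFourierCoeff f.toReal {i}
  convert h using 2 with ε
  · have hE := cubeExp_noiseOp ε f.toReal
    change _ = f.mean at hE
    rw [cubeExp, div_eq_iff (by positivity)] at hE
    rw [← sum_div, sum_sub_distrib, sum_sub_distrib, ← mul_sum, sum_sub_distrib, hE,
      BoolFun.stability, cubeExp]
    simp only [sum_const, card_univ_cube, nsmul_eq_mul, Nat.cast_pow, Nat.cast_ofNat]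
    field_simp
    ring
  · rw [← mul_sum, mul_div_assoc]
    change _ = _ * cubeExp _
    rw [hW, BoolFun.degOneWeight]
    simp only [mul_pow, ← mul_sum]
    ring

theorem eventually_stability_lt_of_degOneWeight_lt {n : ℕ} {α : ℝ} (hα : 1 < α) {f g : BoolFun n}
    (hfg : f.mean = g.mean) (hW : g.degOneWeight < f.degOneWeight) :
    ∀ᶠ ε in 𝓝[≠] (1 / 2 : ℝ), g.stability α ε < f.stability α ε := by
  -- The Taylor expansion needs a positive mean. At mean zero both functions vanish and their
  -- weights could not differ.
  have hm : 0 < f.mean := by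
    rw [BoolFun.mean_eq_card]
    refine div_pos ?_ (by positivity)
    rw [Nat.cast_pos, Nat.pos_iff_ne_zero]
    intro h0
    have hg := (BoolFun.card_supp_eq_of_mean_eq hfg).symm.trans h0
    refine hW.ne ?_
    rw [card_eq_zero] at h0 hg
    have : g.toReal = f.toReal := by
      ext x; rw [BoolFun.toReal_eq_ite, BoolFun.toReal_eq_ite, h0, hg]
    rw [BoolFun.degOneWeight, BoolFun.degOneWeight, this]
  have h := tendsto_stability_half α f hm
  have h' := tendsto_stability_half α g (hfg ▸ hm)
  rw [← hfg] at h'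
  have hlt : 2 * α * (α - 1) * f.mean ^ (α - 2) * g.degOneWeight <
      2 * α * (α - 1) * f.mean ^ (α - 2) * f.degOneWeight := by
    have := Real.rpow_pos_of_pos hm (α - 2)
    have h1 : 0 < α - 1 := by linarith
    have h2 : 0 < α := by linarith
    gcongr
  filter_upwards [h'.eventually_lt h hlt, self_mem_nhdsWithin] with ε hε hne
  have hsq : 0 < (ε - 1 / 2) ^ 2 := by
    have : ε - 1 / 2 ≠ 0 := sub_ne_zero.2 hne
    positivity
  have := (div_lt_div_iff_of_pos_right hsq).1 hε
  linarith

/-! ### The degree-1 weight bound and its equality case -/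

theorem sum_mul_walsh_singleton {n : ℕ} (g : Cube n → ℝ) (i : Fin n) :
    ∑ x, g x * walsh {i} x = 2 ^ n * cubeFourierCoeff g {i} := by
  rw [cubeFourierCoeff, cubeExp]
  field_simp

namespace BoolFun

theorem toReal_eq_zero_or_one {n : ℕ} (g : BoolFun n) (x : Cube n) :
    g.toReal x = 0 ∨ g.toReal x = 1 := by
  rw [toReal_eq_ite]; split_ifs <;> simp

/-- Pythagoras: `g - 1/2` has square `1/4` everywhere, and constants are orthogonal to degree 1, so
`g` need not be balanced. -/
theorem cubeExp_sq_sub_linear_part {n : ℕ} (g : BoolFun n) :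
    cubeExp (fun x => (g.toReal x - 1 / 2 - ∑ i, cubeFourierCoeff g.toReal {i} * walsh {i} x) ^ 2) =
      1 / 4 - g.degOneWeight := by
  have h1 := cubeExp_sq_sum_walsh fun i => cubeFourierCoeff g.toReal {i}
  have h2 : ∑ x, (g.toReal x - 1 / 2) * ∑ i, cubeFourierCoeff g.toReal {i} * walsh {i} x =
      2 ^ n * g.degOneWeight := by
    simp only [mul_sum]
    rw [sum_comm, degOneWeight, mul_sum]
    refine sum_congr rfl fun i _ => ?_
    calc _ = cubeFourierCoeff g.toReal {i} *
          (∑ x, g.toReal x * walsh {i} x - 1 / 2 * ∑ x : Cube n, walsh {i} x) := by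
          rw [mul_sum, ← sum_sub_distrib, mul_sum]
          exact sum_congr rfl fun x _ => by ring
      _ = _ := by rw [sum_mul_walsh_singleton, sum_walsh_singleton]; ring
  have h3 (x : Cube n) : (g.toReal x - 1 / 2) ^ 2 = 1 / 4 := by
    rcases g.toReal_eq_zero_or_one x with h | h <;> rw [h] <;> norm_num
  unfold cubeExp at h1 ⊢
  rw [div_eq_iff (by positivity)] at h1 ⊢
  simp only [sub_sq (_ - _), h3]
  rw [sum_add_distrib, sum_sub_distrib, h1]
  simp only [mul_assoc, ← mul_sum]
  rw [h2, ← degOneWeight]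
  simp
  ring

theorem degOneWeight_le {n : ℕ} (g : BoolFun n) :
    g.degOneWeight ≤ 1 / 4 := by
  rw [← sub_nonneg, ← cubeExp_sq_sub_linear_part g]
  exact div_nonneg (sum_nonneg fun _ _ => sq_nonneg _) (by positivity)

/-- Equality makes `g - 1/2` purely of degree 1. If coordinate `i` has a nonzero coefficient,
flipping it always changes `g`, and the sign of the change, which depends on `x i` alone, determines
`g x`. The support is thus a half cube. -/
theorem isEdgeOptimal_of_degOneWeight_eq {n : ℕ} {g : BoolFun n}
    (hW : g.degOneWeight = 1 / 4) : IsEdgeOptimal g.supp := by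
  have h0 := cubeExp_sq_sub_linear_part g
  rw [hW, sub_self, cubeExp, div_eq_iff (by positivity), zero_mul,
    sum_eq_zero_iff_of_nonneg fun _ _ => sq_nonneg _] at h0
  have hlin (x : Cube n) :
      g.toReal x - 1 / 2 = ∑ i, cubeFourierCoeff g.toReal {i} * walsh {i} x :=
    sub_eq_zero.1 (pow_eq_zero_iff two_ne_zero |>.1 (h0 x (mem_univ x)))
  obtain ⟨i, hi⟩ : ∃ i, cubeFourierCoeff g.toReal {i} ≠ 0 := by
    by_contra! hcon
    simp [degOneWeight, hcon] at hW
  have hdiff (x : Cube n) : g.toReal x - g.toReal (x + Pi.single i 1) =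
      2 * (cubeFourierCoeff g.toReal {i} * walsh {i} x) := by
    have h1 : g.toReal x - g.toReal (x + Pi.single i 1) =
        (g.toReal x - 1 / 2) - (g.toReal (x + Pi.single i 1) - 1 / 2) := by ring
    rw [h1, hlin, hlin, ← sum_sub_distrib, Fintype.sum_eq_single i]
    · rw [walsh_singleton_add, walsh_singleton_single, if_pos rfl]; ring
    · intro j hj
      rw [walsh_singleton_add, walsh_singleton_single, if_neg hj.symm]; ring
  have hmem (x : Cube n) : x ∈ g.supp ↔ 0 < cubeFourierCoeff g.toReal {i} * walsh {i} x := by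
    have hne : cubeFourierCoeff g.toReal {i} * walsh {i} x ≠ 0 := by
      refine mul_ne_zero hi fun h => ?_
      have := walsh_singleton_mul_self i x
      simp [h] at this
    have hd := hdiff x
    have hx := g.toReal_eq_ite x
    rcases g.toReal_eq_zero_or_one (x + Pi.single i 1) with h' | h' <;> by_cases h : x ∈ g.supp <;>
      simp only [h, if_true, if_false] at hx <;> rw [hx, h'] at hd <;>
      simp only [h, true_iff, false_iff, not_lt]
    · linarith
    · exact absurd (by linarith) hne
    · exact absurd (by linarith) hne
    · linarith
  rcases hi.lt_or_gt with hneg | hpos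
  · convert isEdgeOptimal_half i 1
    ext x
    rw [hmem, mem_filter, walsh_singleton]
    split_ifs with h
    · simp [h, hneg]
    · simp [h, hneg.le]
  · convert isEdgeOptimal_half i 0
    ext x
    have h01 : x i = 0 ↔ ¬ x i = 1 := by generalize x i = c; revert c; decide
    rw [hmem, mem_filter, walsh_singleton, h01]
    split_ifs with h
    · simp [h, hpos.le]
    · simp [h, hpos]

theorem isEdgeOptimal_supp_dictator {n : ℕ} (i : Fin n) : IsEdgeOptimal (dictator i).supp :=
  isEdgeOptimal_half i 1

theorem toReal_dictator {n : ℕ} (i : Fin n) (x : Cube n) :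
    (dictator i).toReal x = (1 - walsh {i} x) / 2 := by
  rw [toReal_eq_ite, walsh_singleton]
  simp only [mem_supp, dictator]
  split_ifs <;> norm_num

theorem mean_dictator {n : ℕ} (i : Fin n) : (dictator i).mean = 1 / 2 := by
  rw [mean, cubeExp, div_eq_iff (by positivity)]
  simp only [toReal_dictator]
  rw [← sum_div, sum_sub_distrib, sum_walsh_singleton]
  simp
  ring

theorem degOneWeight_dictator {n : ℕ} (i : Fin n) : (dictator i).degOneWeight = 1 / 4 := by
  refine (degOneWeight_le _).antisymm ?_
  have h : cubeFourierCoeff (dictator i).toReal {i} = -1 / 2 := by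
    rw [cubeFourierCoeff, cubeExp, div_eq_iff (by positivity)]
    have (x : Cube n) : (dictator i).toReal x * walsh {i} x = (walsh {i} x - 1) / 2 := by
      rw [toReal_dictator]
      linear_combination (-1 / 2) * walsh_singleton_mul_self i x
    simp only [this]
    rw [← sum_div, sum_sub_distrib, sum_walsh_singleton]
    simp
    ring
  calc (1 / 4 : ℝ) = cubeFourierCoeff (dictator i).toReal {i} ^ 2 := by rw [h]; norm_num
    _ ≤ _ := single_le_sum (f := fun j => cubeFourierCoeff (dictator i).toReal {j} ^ 2)
      (fun _ _ => sq_nonneg _) (mem_univ i)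

/-! ### Uniform noise thresholds and the main theorem -/

theorem IsLexicographic.isEdgeOptimal {n : ℕ} {f : BoolFun n} (hf : f.IsLexicographic) :
    IsEdgeOptimal f.supp := by
  rcases hf with hf | hf
  · exact isEdgeOptimal_of_lex_isLowerSet (by simpa only [mem_supp] using hf)
  · exact isEdgeOptimal_of_lex_isUpperSet (by simpa only [mem_supp] using hf)

theorem exists_isLexicographic {n : ℕ} (h : BoolFun n) :
    ∃ f : BoolFun n, f.IsLexicographic ∧ f.mean = h.mean := by
  obtain ⟨A, hA, hlex⟩ := exists_lex_isLowerSet (card_cube_le h.supp)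
  have hf (x : Cube n) : (if x ∈ A then (1 : Fin 2) else 0) = 1 ↔ x ∈ A := by
    split_ifs with hx <;> simp [hx]
  refine ⟨fun x => if x ∈ A then 1 else 0, Or.inl fun x y hxy hy => ?_, ?_⟩
  · rw [hf] at hy ⊢
    exact hlex x y hxy hy
  · have hs : supp (fun x => if x ∈ A then 1 else 0) = A := by
      ext x; rw [mem_supp, hf]
    rw [mean_eq_card, mean_eq_card, hs, hA]

theorem stability_half {n : ℕ} (α : ℝ) (f : BoolFun n) : f.stability α (1 / 2) = f.mean ^ α := by
  simp only [stability, noiseOp_half, cubeExp]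
  simp [mean, cubeExp]

theorem exists_weak_noise_bound {α : ℝ} (hα : 1 < α) (n : ℕ) :
    ∃ δ > 0, ∀ ε ∈ Set.Icc 0 δ, ∀ f g : BoolFun n, f.mean = g.mean → IsEdgeOptimal f.supp →
      g.stability α ε ≤ f.stability α ε := by
  have h : ∀ᶠ ε in 𝓝[>] (0 : ℝ), ∀ f g : BoolFun n, f.mean = g.mean →
      spannedEdges g.supp < spannedEdges f.supp → g.stability α ε < f.stability α ε := by
    simp only [eventually_all]
    exact fun f g hfg hE => eventually_stability_lt_of_spannedEdges_lt hα hfg hE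
  obtain ⟨δ, hδ, hsub⟩ := mem_nhdsGT_iff_exists_Ioc_subset.1 h
  refine ⟨δ, hδ, fun ε hε f g hfg hf => ?_⟩
  have hcard := card_supp_eq_of_mean_eq hfg
  rcases hε.1.eq_or_lt with rfl | hpos
  · rw [stability_zero hα, stability_zero hα, hfg]
  · have hle := spannedEdges_le g.supp
    rw [← hcard, ← hf] at hle
    -- A tie in the edge count makes `g` optimal too, so isometry gives equal stability; otherwise
    -- the derivative decides.
    rcases hle.eq_or_lt with heq | hlt
    · refine le_of_eq (CubeIsometric.stability_eq (IsEdgeOptimal.cubeIsometric ?_ hf hcard.symm) α ε)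
      rw [IsEdgeOptimal, heq, hf, hcard]
    · exact (hsub ⟨hpos, hε.2⟩ f g hfg hlt).le

theorem exists_strong_noise_bound {α : ℝ} (hα : 1 < α) (n : ℕ) :
    ∃ δ > 0, ∀ ε ∈ Set.Ico (1 / 2 - δ) (1 / 2), ∀ f g : BoolFun n, f.mean = g.mean →
      g.degOneWeight < f.degOneWeight → g.stability α ε < f.stability α ε := by
  have h : ∀ᶠ ε in 𝓝[<] (1 / 2 : ℝ), ∀ f g : BoolFun n, f.mean = g.mean →
      g.degOneWeight < f.degOneWeight → g.stability α ε < f.stability α ε := by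
    simp only [eventually_all]
    exact fun f g hfg hW => (eventually_stability_lt_of_degOneWeight_lt hα hfg hW).filter_mono
      (nhdsWithin_mono _ fun x (hx : x < 1 / 2) => hx.ne)
  obtain ⟨l, hl, hsub⟩ := mem_nhdsLT_iff_exists_Ico_subset.1 h
  refine ⟨1 / 2 - l, sub_pos.2 hl, fun ε hε => hsub ?_⟩
  rwa [sub_sub_cancel] at hε

end BoolFun

theorem mainTheorem1 (α : ℝ) (hα : 1 < α) (n : ℕ) :
    ∃ δ : ℝ, 0 < δ ∧ δ < 1 / 2 ∧
      -- for every attainable value `m` of the mean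
      (∀ m : ℝ, (∃ h : BoolFun n, h.mean = m) →
        -- weak noise
        ((∃ f : BoolFun n, f.IsLexicographic ∧ f.mean = m) ∧
          ∀ ε ∈ Set.Icc 0 δ, ∀ f : BoolFun n, f.IsLexicographic → f.mean = m →
            f.MaximizesStability α ε m) ∧
        -- strong noise
        (∀ ε ∈ Set.Ico (1 / 2 - δ) (1 / 2),
          (∃ f : BoolFun n, f.MaximizesDegOneWeight m ∧ f.MaximizesStability α ε m) ∧
          (∀ f : BoolFun n, f.MaximizesStability α ε m → f.MaximizesDegOneWeight m) ∧
          (∀ f g : BoolFun n, f.MaximizesDegOneWeight m → g.mean = m →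
            ¬ g.MaximizesDegOneWeight m → g.stability α ε < f.stability α ε))) ∧
      -- balanced functions, both regimes
      (∀ i : Fin n, (BoolFun.dictator i).IsBalanced ∧
        ∀ ε ∈ Set.Icc 0 δ ∪ Set.Icc (1 / 2 - δ) (1 / 2), ∀ g : BoolFun n, g.IsBalanced →
          g.stability α ε ≤ (BoolFun.dictator i).stability α ε) := by
  obtain ⟨δ₁, hδ₁, hweak⟩ := BoolFun.exists_weak_noise_bound hα n
  obtain ⟨δ₂, hδ₂, hstrong⟩ := BoolFun.exists_strong_noise_bound hα n
  have hle₁ : min (min δ₁ δ₂) (1 / 4) ≤ δ₁ := (min_le_left _ _).trans (min_le_left _ _)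
  have hle₂ : min (min δ₁ δ₂) (1 / 4) ≤ δ₂ := (min_le_left _ _).trans (min_le_right _ _)
  -- The `1 / 4` only keeps the threshold below `1 / 2`.
  refine ⟨min (min δ₁ δ₂) (1 / 4), by positivity, (min_le_right _ _).trans_lt (by norm_num), ?_, ?_⟩
  · rintro m ⟨h, rfl⟩
    refine ⟨⟨h.exists_isLexicographic, fun ε hε f hf hm => ⟨hm, fun g hg => ?_⟩⟩, fun ε hε => ?_⟩
    · exact hweak ε ⟨hε.1, hε.2.trans hle₁⟩ f g (hm.trans hg.symm) hf.isEdgeOptimal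
    · have hlt := hstrong ε ⟨by linarith [hε.1], hε.2⟩
      have hmax (f : BoolFun n) (hf : f.MaximizesStability α ε h.mean) :
          f.MaximizesDegOneWeight h.mean := by
        refine ⟨hf.1, fun g hg => ?_⟩
        by_contra! hcon
        exact (hlt g f (hg.trans hf.1.symm) hcon).not_ge (hf.2 g hg)
      refine ⟨?_, hmax, fun f g hf hg hng => ?_⟩
      · obtain ⟨f, hf, hfmax⟩ := Set.exists_max_image {f : BoolFun n | f.mean = h.mean}
          (fun f => f.stability α ε) (Set.toFinite _) ⟨h, rfl⟩
        exact ⟨f, hmax f ⟨hf, hfmax⟩, hf, hfmax⟩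
      · refine hlt f g (hf.1.trans hg.symm) ((hf.2 g hg).lt_of_ne fun heq => hng ⟨hg, fun k hk => ?_⟩)
        exact heq ▸ hf.2 k hk
  · refine fun i => ⟨(BoolFun.isBalanced_iff _).2 (BoolFun.mean_dictator i), fun ε hε g hg => ?_⟩
    rw [BoolFun.isBalanced_iff] at hg
    have hmean := (BoolFun.mean_dictator i).trans hg.symm
    rcases hε with hε | hε
    · exact hweak ε ⟨hε.1, hε.2.trans hle₁⟩ _ g hmean (BoolFun.isEdgeOptimal_supp_dictator i)
    rcases hε.2.eq_or_lt with rfl | hhalf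
    · rw [BoolFun.stability_half, BoolFun.stability_half, hmean]
    have hW := BoolFun.degOneWeight_le g
    -- `exists_strong_noise_bound` says nothing about equal weights; weight `1/4` is handled by
    -- isometry with the dictator.
    rcases hW.eq_or_lt with heq | hlt
    · exact le_of_eq (CubeIsometric.stability_eq
        ((BoolFun.isEdgeOptimal_of_degOneWeight_eq heq).cubeIsometric
          (BoolFun.isEdgeOptimal_supp_dictator i) (BoolFun.card_supp_eq_of_mean_eq hmean.symm)) α ε)
    · rw [← BoolFun.degOneWeight_dictator i] at hlt
      exact (hstrong ε ⟨by linarith [hε.1], hhalf⟩ _ g hmean hlt).le
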